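/- **Setting.** Let $R$ be a commutative ring with unit, $V$ a free $R$-module and $B:V\times V\to R$ a bilinear form that is diagonal in a basis $(e_i)_{i\in M}$ of $V$, where $M$ is totally ordered; put $q(i)=B(e_i,e_i)$. Let $W$ be the free $R$-module with basis $(e_K)$, $K$ running over the finite subsets of $M$, with $V\subseteq W$ through $e_i=e_{\{i\}}$. The Clifford product on $W$ is the bilinear product with $$e_H e_J=\Big(\prod_{(i,j)\in H\times J,\ j<i}(-1)\Big)\Big(\prod_{i\in H\cap J}q(i)\Big)\,e_{H\triangle J},$$ and the outer product $\wedge$ is the product given by the same formula with $q$ replaced by $0$. On $W$ define bilinear maps $*$ (scalar product), $\rfloor$ (left contraction) and $\lfloor$ (right contraction) by: $e_H*e_K=e_He_K$ if $H=K$ and $0$ otherwise; $e_H\rfloor e_K=e_He_K$ if $H\subseteq K$ and $0$ otherwise; $e_H\lfloor e_K=e_He_K$ if $H\supseteq K$ and $0$ otherwise. A geometric algebra $\Lambda(V,B)$ is an $R$-module containing $V$ with two (associative, unital) algebra structures, a Clifford one (product $XY$, unit $1_{Cl}$) and a Grassmann one (product $X\wedge Y$, unit $1_\Lambda$), that is isomorphic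 to $W$ with its two products by a linear isomorphism fixing $V$ and respecting both products; $*,\rfloor,\lfloor$ are carried over by the isomorphism. For $r\in\mathbb Z$ the subspace $\Lambda_r$ of elements of grade $r$ is the span of the outer products of $r$ vectors ($\Lambda_r=0$ for $r<0$), and $\langle X\rangle_r$ is the projection of $X$ onto $\Lambda_r$ along $\bigoplus_{i\ne r}\Lambda_i$. A reversion of either algebra structure is the unique linear map fixing the unit and all vectors and reversing products; $\widetilde X$ is the reversion of the Clifford structure. $X\mapsto\hat X$ is the unique Clifford algebra endomorphism with $\hat x=-x$ for $x\in V$. **Theorem 3.** In a geometric algebra $\Lambda(V,B)$ the following hold for all vectors $x,y,x_1,\dots,x_p\in V$ ($p\ge 0$) and all elements $X,Y,Z$. 1. $1_{Cl}=1_\Lambda$ and $xX=x\wedge X+x\rfloor X$. 2. The Clifford and the Grassmann structure have the same reversion, and $\widetilde X=(-1)^{r(r-1)/2}X$ for $X$ of grade $r$. 3. (a) $(X\lfloor Y)^\sim=\widetilde Y\rfloor\widetilde X$ and $X*Y=\langle XY\rangle_0$. (b) If $X$ has grade $r$ and $Y$ has grade $s$, then $X\wedge Y=\langle XY\rangle_{r+s}$,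 $X\rfloor Y=\langle XY\rangle_{s-r}$, $X\lfloor Y=\langle XY\rangle_{r-s}$ and $$XY=\sum_{i=|r-s|,\ \text{step }2}^{r+s}\langle XY\rangle_i .$$ 4. $(X\wedge Y)\rfloor Z=X\rfloor(Y\rfloor Z)$. 5. $x\rfloor y=B(x,y)1_\Lambda$ and $x\rfloor(XY)=(x\rfloor X)Y+\hat X(x\rfloor Y)$. 6. $x\rfloor(X\wedge Y)=(x\rfloor X)\wedge Y+\hat X\wedge(x\rfloor Y)$. 7. $x\rfloor(x_1x_2\cdots x_p)=\sum_{k=1}^p(-1)^{k-1}x_1x_2\cdots(x\rfloor x_k)\cdots x_p$. 8. $x\rfloor(x_1\wedge x_2\wedge\dots\wedge x_p)=\sum_{k=1}^p(-1)^{k-1}x_1\wedge x_2\wedge\dots\wedge(x\rfloor x_k)\wedge\dots\wedge x_p$. 9. If $x_1,\dots,x_p$ are pairwise orthogonal ($B(x_i,x_j)=0$ for $i\ne j$), then $x_1x_2\cdots x_p=x_1\wedge x_2\wedge\dots\wedge x_p$. -/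

import Mathlib

noncomputable section

namespace GeomAlg

/-! ### Algebra structures and double algebras on one linear space -/

/-- An `R`-algebra structure (bilinear, associative, with unit) on a given `R`-module `U`.
It is a plain structure and not a type class since one module will carry two of them. -/
structure AlgStr (R U : Type*) [CommRing R] [AddCommGroup U] [Module R U] where
  /-- the product -/
  mul : U →ₗ[R] U →ₗ[R] U
  /-- the unit -/
  one : U
  mul_assoc : ∀ X Y Z, mul (mul X Y) Z = mul X (mul Y Z)
  one_mul : ∀ X, mul one X = X
  mul_one : ∀ X, mul X one = X

/-- The ordered product `f 0 * f 1 * ... * f (n - 1)`, the unit for `n = 0`. -/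
def AlgStr.prod {R U : Type*} [CommRing R] [AddCommGroup U] [Module R U] (A : AlgStr R U)
    {n : ℕ} (f : Fin n → U) : U :=
  (List.ofFn f).foldr (fun X Y => A.mul X Y) A.one

/-- `ρ` is a reversion of the algebra `A` on `U`, where `ι : V → U` is the given copy of `V`:
a linear map that reverses products and fixes the unit and all vectors. -/
structure IsReversion {R V U : Type*} [CommRing R] [AddCommGroup V] [Module R V]
    [AddCommGroup U] [Module R U] (A : AlgStr R U) (ι : V →ₗ[R] U) (ρ : U →ₗ[R] U) : Prop where
  map_mul : ∀ X Y, ρ (A.mul X Y) = A.mul (ρ Y) (ρ X)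
  map_one : ρ A.one = A.one
  map_vec : ∀ x, ρ (ι x) = ι x

/-- `φ` is a main automorphism of the algebra `A` on `U`: an algebra morphism that
extends `x ↦ -x` from `V`. -/
structure IsMainAut {R V U : Type*} [CommRing R] [AddCommGroup V] [Module R V]
    [AddCommGroup U] [Module R U] (A : AlgStr R U) (ι : V →ₗ[R] U) (φ : U →ₗ[R] U) : Prop where
  map_mul : ∀ X Y, φ (A.mul X Y) = A.mul (φ X) (φ Y)
  map_one : φ A.one = A.one
  map_vec : ∀ x, φ (ι x) = -ι x

/-- A double algebra: one module `U` with two algebra structures, the Clifford one `cl` and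
the Grassmann (exterior) one `ext`, together with a copy `ι` of `V` in `U`. -/
structure DoubleAlgebra (R V U : Type*) [CommRing R] [AddCommGroup V] [Module R V]
    [AddCommGroup U] [Module R U] where
  /-- the Clifford structure -/
  cl : AlgStr R U
  /-- the Grassmann structure -/
  ext : AlgStr R U
  /-- the vectors -/
  ι : V →ₗ[R] U

/-- An isomorphism of double algebras fixing `V`. (Units are then preserved automatically.) -/
structure DoubleIso {R V U U' : Type*} [CommRing R] [AddCommGroup V] [Module R V]
    [AddCommGroup U] [Module R U] [AddCommGroup U'] [Module R U']
    (D : DoubleAlgebra R V U) (D' : DoubleAlgebra R V U') where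
  /-- the underlying linear isomorphism -/
  toEquiv : U ≃ₗ[R] U'
  map_cl : ∀ X Y, toEquiv (D.cl.mul X Y) = D'.cl.mul (toEquiv X) (toEquiv Y)
  map_ext : ∀ X Y, toEquiv (D.ext.mul X Y) = D'.ext.mul (toEquiv X) (toEquiv Y)
  map_ι : ∀ x, toEquiv (D.ι x) = D'.ι x

/-! ### The model `W`, free on the blades `e_K`, `K` a finite subset of `M` -/

section Model

variable {R M : Type*} [CommRing R]

/-- The basis blade `e_K`. -/
def eb (K : Finset M) : Finset M →₀ R := Finsupp.single K 1

/-- The bilinear map on `W` with prescribed values on pairs of basis blades. -/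
def onBlades (f : Finset M → Finset M → (Finset M →₀ R)) :
    (Finset M →₀ R) →ₗ[R] (Finset M →₀ R) →ₗ[R] (Finset M →₀ R) :=
  Finsupp.linearCombination R (fun H => Finsupp.linearCombination R (fun J => f H J))

theorem onBlades_eb (f : Finset M → Finset M → (Finset M →₀ R)) (H J : Finset M) :
    onBlades f (eb H) (eb J) = f H J := by
  simp [onBlades, eb]

theorem hom_ext_eb {N : Type*} [AddCommGroup N] [Module R N] {f g : (Finset M →₀ R) →ₗ[R] N}
    (h : ∀ K, f (eb K) = g (eb K)) : f = g :=
  Finsupp.lhom_ext' (fun K => LinearMap.ext_ring (h K))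

variable {V : Type*} [AddCommGroup V] [Module R V]

/-- The inclusion `V → W`, given by `e_i ↦ e_{\{i\}}`. -/
def bladeVec (e : Module.Basis M R V) : V →ₗ[R] (Finset M →₀ R) :=
  e.constr R (fun i => (eb {i} : Finset M →₀ R))

theorem bladeVec_basis (e : Module.Basis M R V) (i : M) : bladeVec e (e i) = eb {i} := by
  simp [bladeVec]

variable [LinearOrder M]

/-- The ordering sign: a factor `-1` for each `(i, j) ∈ H × J` with `j < i`. -/
def alpha (R : Type*) [CommRing R] (H J : Finset M) : R :=
  ∏ _p ∈ (H ×ˢ J).filter (fun p => p.2 < p.1), (-1 : R)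

/-- The reduction factor: the product of `q i` for `i ∈ H ∩ J`. -/
def beta (q : M → R) (H J : Finset M) : R := ∏ i ∈ H ∩ J, q i

/-- `σ = α β`. -/
def sigma (q : M → R) (H J : Finset M) : R := alpha R H J * beta q H J

/-- The product `e_H e_J = σ(H, J) e_{H ∆ J}` on `W`. -/
def bladeMul (q : M → R) :
    (Finset M →₀ R) →ₗ[R] (Finset M →₀ R) →ₗ[R] (Finset M →₀ R) :=
  onBlades (fun H J => sigma q H J • eb (symmDiff H J))

theorem bladeMul_eb (q : M → R) (H J : Finset M) :
    bladeMul q (eb H) (eb J) = sigma q H J • eb (symmDiff H J) :=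
  onBlades_eb _ _ _

theorem prod_symmDiff_of_sq (f : M → R) (hf : ∀ i, f i * f i = 1) (H J : Finset M) :
    ∏ i ∈ symmDiff H J, f i = (∏ i ∈ H, f i) * ∏ i ∈ J, f i := by
  have h1 : (∏ i ∈ H ∩ J, f i) * ∏ i ∈ H ∩ J, f i = 1 := by
    rw [← Finset.prod_mul_distrib]; exact Finset.prod_eq_one (fun i _ => hf i)
  have h2 : symmDiff H J = (H \ J) ∪ (J \ H) := rfl
  have h3 : Disjoint (H \ J) (J \ H) := by
    rw [Finset.disjoint_left]; intro a; simp; tauto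
  rw [h2, Finset.prod_union h3, ← Finset.prod_inter_mul_prod_sdiff H J f,
    ← Finset.prod_inter_mul_prod_sdiff J H f, Finset.inter_comm J H]
  linear_combination (-(∏ i ∈ H \ J, f i) * ∏ i ∈ J \ H, f i) * h1

theorem alpha_eq (H J : Finset M) :
    alpha R H J = ∏ i ∈ H, ∏ j ∈ J, if j < i then (-1 : R) else 1 := by
  rw [alpha, Finset.prod_filter, Finset.prod_product]

theorem alpha_symmDiff_left (H J K : Finset M) :
    alpha R (symmDiff H J) K = alpha R H K * alpha R J K := by
  simp only [alpha_eq]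
  apply prod_symmDiff_of_sq
  intro i
  rw [← Finset.prod_mul_distrib]
  exact Finset.prod_eq_one (fun j _ => by split_ifs <;> simp)

theorem alpha_symmDiff_right (H J K : Finset M) :
    alpha R H (symmDiff J K) = alpha R H J * alpha R H K := by
  simp only [alpha_eq]
  rw [← Finset.prod_mul_distrib]
  refine Finset.prod_congr rfl (fun i _ => ?_)
  apply prod_symmDiff_of_sq
  intro j
  split_ifs <;> simp

theorem beta_cocycle (q : M → R) (H J K : Finset M) :
    beta q H J * beta q (symmDiff H J) K = beta q H (symmDiff J K) * beta q J K := by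
  unfold beta
  rw [← Finset.prod_union, ← Finset.prod_union]
  · congr 1
    ext a
    simp only [Finset.mem_union, Finset.mem_inter, Finset.mem_symmDiff]
    tauto
  · rw [Finset.disjoint_left]; intro a
    simp only [Finset.mem_inter, Finset.mem_symmDiff]; tauto
  · rw [Finset.disjoint_left]; intro a
    simp only [Finset.mem_inter, Finset.mem_symmDiff]; tauto

theorem sigma_cocycle (q : M → R) (H J K : Finset M) :
    sigma q H J * sigma q (symmDiff H J) K = sigma q H (symmDiff J K) * sigma q J K := by
  unfold sigma
  rw [alpha_symmDiff_left, alpha_symmDiff_right]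
  linear_combination (alpha R H J * alpha R H K * alpha R J K) * beta_cocycle q H J K

theorem bladeMul_assoc (q : M → R) (X Y Z : Finset M →₀ R) :
    bladeMul q (bladeMul q X Y) Z = bladeMul q X (bladeMul q Y Z) := by
  have h : (bladeMul q).compr₂ (bladeMul q) =
      ((LinearMap.llcomp R (Finset M →₀ R) (Finset M →₀ R) (Finset M →₀ R)).flip.comp
        (bladeMul q)).flip.comp (bladeMul q) := by
    refine hom_ext_eb (fun H => hom_ext_eb (fun J => hom_ext_eb (fun K => ?_)))
    simp only [LinearMap.compr₂_apply, LinearMap.comp_apply, LinearMap.flip_apply,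
      LinearMap.llcomp_apply, bladeMul_eb, map_smul, LinearMap.smul_apply, smul_smul,
      symmDiff_assoc]
    rw [sigma_cocycle, mul_comm]
  exact LinearMap.congr_fun (LinearMap.congr_fun (LinearMap.congr_fun h X) Y) Z

theorem bladeMul_one (q : M → R) (X : Finset M →₀ R) : bladeMul q X (eb ∅) = X := by
  have h : (bladeMul q).flip (eb ∅) = LinearMap.id := by
    refine hom_ext_eb (fun H => ?_)
    have h0 : symmDiff H ∅ = H := symmDiff_bot H
    simp [bladeMul_eb, sigma, alpha, beta, h0]
  exact LinearMap.congr_fun h X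

theorem bladeMul_one_left (q : M → R) (X : Finset M →₀ R) : bladeMul q (eb ∅) X = X := by
  have h : (bladeMul q) (eb ∅) = LinearMap.id := by
    refine hom_ext_eb (fun H => ?_)
    have h0 : symmDiff ∅ H = H := bot_symmDiff H
    simp [bladeMul_eb, sigma, alpha, beta, h0]
  exact LinearMap.congr_fun h X

/-- The algebra `W` for the diagonal form `q`. -/
def bladeAlg (q : M → R) : AlgStr R (Finset M →₀ R) where
  mul := bladeMul q
  one := eb ∅
  mul_assoc := bladeMul_assoc q
  one_mul := bladeMul_one_left q
  mul_one := bladeMul_one q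

/-- The scalar product `e_H ∗ e_K = χ(H = K) e_H e_K`. -/
def bladeScalar (q : M → R) :
    (Finset M →₀ R) →ₗ[R] (Finset M →₀ R) →ₗ[R] (Finset M →₀ R) :=
  onBlades (fun H K => if H = K then bladeMul q (eb H) (eb K) else 0)

/-- The left contraction `e_H ⌋ e_K = χ(H ⊆ K) e_H e_K`. -/
def bladeLeft (q : M → R) :
    (Finset M →₀ R) →ₗ[R] (Finset M →₀ R) →ₗ[R] (Finset M →₀ R) :=
  onBlades (fun H K => if H ⊆ K then bladeMul q (eb H) (eb K) else 0)

/-- The right contraction `e_H ⌊ e_K = χ(H ⊇ K) e_H e_K`. -/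
def bladeRight (q : M → R) :
    (Finset M →₀ R) →ₗ[R] (Finset M →₀ R) →ₗ[R] (Finset M →₀ R) :=
  onBlades (fun H K => if K ⊆ H then bladeMul q (eb H) (eb K) else 0)

/-- The double algebra `W_{B,0}` built from the basis `e`, with `q i = B (e i) (e i)` for the
Clifford structure and `q = 0` for the Grassmann structure. -/
def model (B : LinearMap.BilinForm R V) (e : Module.Basis M R V) :
    DoubleAlgebra R V (Finset M →₀ R) where
  cl := bladeAlg (fun i => B (e i) (e i))
  ext := bladeAlg (fun _ => 0)
  ι := bladeVec e

end Model

/-- A geometric algebra over `B`: a double algebra on `U` together with an isomorphism, fixing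
`V`, from the model double algebra built from the basis `e` (which is to be orthogonal
for `B`). -/
structure GeometricAlgebra {R M V : Type*} [CommRing R] [LinearOrder M] [AddCommGroup V]
    [Module R V] (B : LinearMap.BilinForm R V) (e : Module.Basis M R V)
    (U : Type*) [AddCommGroup U] [Module R U] extends DoubleAlgebra R V U where
  /-- the isomorphism from the model -/
  iso : DoubleIso (model B e) toDoubleAlgebra

/-- The subspace of elements of grade `r ∈ ℤ`: the span of the outer products of `r` vectors;
it is zero for negative `r`. -/
def DoubleAlgebra.grade {R V U : Type*} [CommRing R] [AddCommGroup V] [Module R V]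
    [AddCommGroup U] [Module R U] (D : DoubleAlgebra R V U) (r : ℤ) : Submodule R U :=
  Submodule.span R {X | ∃ n : ℕ, (n : ℤ) = r ∧ ∃ v : Fin n → V,
    X = D.ext.prod (fun i => D.ι (v i))}

/-! ### The constructions in a geometric algebra that rest on existence and uniqueness -/

section Represented

theorem AlgStr.prod_zero {R U : Type*} [CommRing R] [AddCommGroup U] [Module R U]
    (A : AlgStr R U) (f : Fin 0 → U) : A.prod f = A.one := by
  simp [AlgStr.prod]

theorem AlgStr.prod_succ {R U : Type*} [CommRing R] [AddCommGroup U] [Module R U]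
    (A : AlgStr R U) {n : ℕ} (f : Fin (n + 1) → U) :
    A.prod f = A.mul (f 0) (A.prod (fun i => f i.succ)) := by
  simp [AlgStr.prod, List.ofFn_succ]

variable {R M V U : Type*} [CommRing R] [LinearOrder M] [AddCommGroup V] [Module R V]
  [AddCommGroup U] [Module R U]

/-- `A` is the algebra of `q` carried over along `Φ`, which fixes `V`. -/
structure Represents (e : Module.Basis M R V) (q : M → R) (A : AlgStr R U) (ι : V →ₗ[R] U)
    (Φ : (Finset M →₀ R) ≃ₗ[R] U) : Prop where
  map_mul : ∀ X Y, Φ (bladeMul q X Y) = A.mul (Φ X) (Φ Y)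
  map_vec : ∀ x, Φ (bladeVec e x) = ι x

theorem hom_ext_of_equiv (Φ : (Finset M →₀ R) ≃ₗ[R] U) {N : Type*} [AddCommGroup N] [Module R N]
    {f g : U →ₗ[R] N} (h : ∀ K, f (Φ (eb K)) = g (Φ (eb K))) : f = g := by
  have h1 : f.comp Φ.toLinearMap = g.comp Φ.toLinearMap := hom_ext_eb h
  ext X
  have h2 := LinearMap.congr_fun h1 (Φ.symm X)
  simpa using h2

theorem Represents.one {e : Module.Basis M R V} {q : M → R} {A : AlgStr R U} {ι : V →ₗ[R] U}
    {Φ : (Finset M →₀ R) ≃ₗ[R] U} (h : Represents e q A ι Φ) : A.one = Φ (eb ∅) := by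
  have h1 := h.map_mul (Φ.symm A.one) (eb ∅)
  rw [bladeMul_one, Φ.apply_symm_apply, A.one_mul] at h1
  exact h1

theorem Represents.symm_mul {e : Module.Basis M R V} {q : M → R} {A : AlgStr R U}
    {ι : V →ₗ[R] U} {Φ : (Finset M →₀ R) ≃ₗ[R] U} (h : Represents e q A ι Φ) (X Y : U) :
    Φ.symm (A.mul X Y) = bladeMul q (Φ.symm X) (Φ.symm Y) := by
  rw [LinearEquiv.symm_apply_eq, h.map_mul, Φ.apply_symm_apply, Φ.apply_symm_apply]

theorem bladeMul_insert (q : M → R) {a : M} {s : Finset M} (ha : ∀ x ∈ s, a < x) :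
    bladeMul q (eb {a}) (eb s) = eb (insert a s) := by
  have has : a ∉ s := fun h => lt_irrefl _ (ha a h)
  have h1 : alpha R {a} s = 1 := by
    rw [alpha_eq, Finset.prod_singleton]
    exact Finset.prod_eq_one (fun j hj => if_neg (not_lt.mpr (ha j hj).le))
  have h2 : beta q {a} s = 1 := by
    rw [beta, Finset.singleton_inter_of_notMem has, Finset.prod_empty]
  have h3 : symmDiff {a} s = insert a s := by
    ext x
    simp only [Finset.mem_symmDiff, Finset.mem_singleton, Finset.mem_insert]
    constructor
    · tauto
    · rintro (rfl | hx)
      · exact Or.inl ⟨rfl, has⟩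
      · refine Or.inr ⟨hx, ?_⟩
        rintro rfl
        exact has hx
  rw [bladeMul_eb, sigma, h1, h2, h3, one_mul, one_smul]

theorem Represents.exists_prod {e : Module.Basis M R V} {q : M → R} {A : AlgStr R U}
    {ι : V →ₗ[R] U} {Φ : (Finset M →₀ R) ≃ₗ[R] U} (h : Represents e q A ι Φ) (K : Finset M) :
    ∃ n : ℕ, n = K.card ∧ ∃ v : Fin n → V, Φ (eb K) = A.prod (fun i => ι (v i)) := by
  induction K using Finset.induction_on_min with
  | empty => exact ⟨0, rfl, Fin.elim0, by rw [A.prod_zero, h.one]⟩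
  | insert a s ha ih =>
    obtain ⟨n, hn, v, hv⟩ := ih
    have has : a ∉ s := fun h => lt_irrefl _ (ha a h)
    refine ⟨n + 1, by rw [Finset.card_insert_of_notMem has, hn],
      Fin.cons (e a) v, ?_⟩
    rw [A.prod_succ]
    simp only [Fin.cons_zero, Fin.cons_succ]
    rw [← hv, ← bladeMul_insert q ha, h.map_mul, ← h.map_vec, bladeVec_basis]

theorem IsReversion.eq_on_prod {A : AlgStr R U} {ι : V →ₗ[R] U} {ρ ρ' : U →ₗ[R] U}
    (h : IsReversion A ι ρ) (h' : IsReversion A ι ρ') (n : ℕ) (v : Fin n → V) :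
    ρ (A.prod (fun i => ι (v i))) = ρ' (A.prod (fun i => ι (v i))) := by
  induction n with
  | zero => rw [A.prod_zero, h.map_one, h'.map_one]
  | succ n ih =>
    rw [A.prod_succ, h.map_mul, h'.map_mul, h.map_vec, h'.map_vec, ih (fun i => v i.succ)]

theorem IsMainAut.eq_on_prod {A : AlgStr R U} {ι : V →ₗ[R] U} {ρ ρ' : U →ₗ[R] U}
    (h : IsMainAut A ι ρ) (h' : IsMainAut A ι ρ') (n : ℕ) (v : Fin n → V) :
    ρ (A.prod (fun i => ι (v i))) = ρ' (A.prod (fun i => ι (v i))) := by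
  induction n with
  | zero => rw [A.prod_zero, h.map_one, h'.map_one]
  | succ n ih =>
    rw [A.prod_succ, h.map_mul, h'.map_mul, h.map_vec, h'.map_vec, ih (fun i => v i.succ)]

/-- The linear map of `W` that scales `e_K` by `c K`. -/
def bladeScale (c : Finset M → R) : (Finset M →₀ R) →ₗ[R] (Finset M →₀ R) :=
  Finsupp.linearCombination R (fun K => c K • (eb K : Finset M →₀ R))

theorem bladeScale_eb (c : Finset M → R) (K : Finset M) :
    bladeScale c (eb K) = c K • eb K := by
  simp [bladeScale, eb]

theorem bladeScale_vec (e : Module.Basis M R V) (c : Finset M → R) (a : R)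
    (hc : ∀ i, c {i} = a) (x : V) : bladeScale c (bladeVec e x) = a • bladeVec e x := by
  have h : (bladeScale c).comp (bladeVec e) = a • bladeVec e := by
    refine e.ext (fun i => ?_)
    simp [bladeVec_basis, bladeScale_eb, hc]
  exact LinearMap.congr_fun h x

theorem alpha_sq (H J : Finset M) : alpha R H J * alpha R H J = (1 : R) := by
  rw [alpha, ← Finset.prod_mul_distrib]
  exact Finset.prod_eq_one (fun _ _ => by simp)

theorem Represents.existsUnique_reversion {e : Module.Basis M R V} {q : M → R} {A : AlgStr R U}
    {ι : V →ₗ[R] U} {Φ : (Finset M →₀ R) ≃ₗ[R] U} (h : Represents e q A ι Φ) :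
    ∃! ρ : U →ₗ[R] U, IsReversion A ι ρ := by
  have hW : ∀ X Y : Finset M →₀ R, bladeScale (fun K => alpha R K K) (bladeMul q X Y) =
      bladeMul q (bladeScale (fun K => alpha R K K) Y) (bladeScale (fun K => alpha R K K) X) := by
    intro X Y
    have h1 : (bladeMul q).compr₂ (bladeScale (fun K => alpha R K K)) =
        ((bladeMul q).compl₁₂ (bladeScale (fun K => alpha R K K))
          (bladeScale (fun K => alpha R K K))).flip := by
      refine hom_ext_eb (fun H => hom_ext_eb (fun J => ?_))
      simp only [LinearMap.compr₂_apply, LinearMap.flip_apply, LinearMap.compl₁₂_apply,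
        bladeMul_eb, map_smul, LinearMap.smul_apply, smul_smul, bladeScale_eb,
        symmDiff_comm J H]
      congr 1
      rw [alpha_symmDiff_left, alpha_symmDiff_right, alpha_symmDiff_right, sigma, sigma,
        show beta q J H = beta q H J by rw [beta, beta, Finset.inter_comm]]
      linear_combination (alpha R H H * alpha R J J * alpha R J H * beta q H J) * alpha_sq (R := R) H J
    exact LinearMap.congr_fun (LinearMap.congr_fun h1 X) Y
  have hex : IsReversion A ι
      (Φ.toLinearMap.comp ((bladeScale (fun K => alpha R K K)).comp Φ.symm.toLinearMap)) := by
    refine ⟨fun X Y => ?_, ?_, fun x => ?_⟩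
    · simp only [LinearMap.comp_apply, LinearEquiv.coe_coe, h.symm_mul, hW, h.map_mul]
    · simp only [h.one, LinearMap.comp_apply, LinearEquiv.coe_coe,
        LinearEquiv.symm_apply_apply, bladeScale_eb, alpha_eq, Finset.prod_empty, one_smul]
    · rw [← h.map_vec]
      simp only [LinearMap.comp_apply, LinearEquiv.coe_coe, LinearEquiv.symm_apply_apply]
      rw [bladeScale_vec e _ 1 (fun i => by simp [alpha_eq]), one_smul]
  refine ⟨_, hex, fun ρ' hρ' => hom_ext_of_equiv Φ (fun K => ?_)⟩
  obtain ⟨n, -, v, hv⟩ := h.exists_prod K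
  rw [hv]
  exact hρ'.eq_on_prod hex n v

theorem Represents.existsUnique_mainAut {e : Module.Basis M R V} {q : M → R} {A : AlgStr R U}
    {ι : V →ₗ[R] U} {Φ : (Finset M →₀ R) ≃ₗ[R] U} (h : Represents e q A ι Φ) :
    ∃! φ : U →ₗ[R] U, IsMainAut A ι φ := by
  have hW : ∀ X Y : Finset M →₀ R,
      bladeScale (fun K => ∏ _i ∈ K, (-1 : R)) (bladeMul q X Y) =
      bladeMul q (bladeScale (fun K => ∏ _i ∈ K, (-1 : R)) X)
        (bladeScale (fun K => ∏ _i ∈ K, (-1 : R)) Y) := by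
    intro X Y
    have h1 : (bladeMul q).compr₂ (bladeScale (fun K => ∏ _i ∈ K, (-1 : R))) =
        (bladeMul q).compl₁₂ (bladeScale (fun K => ∏ _i ∈ K, (-1 : R)))
          (bladeScale (fun K => ∏ _i ∈ K, (-1 : R))) := by
      refine hom_ext_eb (fun H => hom_ext_eb (fun J => ?_))
      simp only [LinearMap.compr₂_apply, LinearMap.compl₁₂_apply,
        bladeMul_eb, map_smul, LinearMap.smul_apply, smul_smul, bladeScale_eb]
      rw [prod_symmDiff_of_sq (fun _ => (-1 : R)) (fun _ => by simp)]
      congr 1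
      ring
    exact LinearMap.congr_fun (LinearMap.congr_fun h1 X) Y
  have hex : IsMainAut A ι
      (Φ.toLinearMap.comp ((bladeScale (fun K => ∏ _i ∈ K, (-1 : R))).comp
        Φ.symm.toLinearMap)) := by
    refine ⟨fun X Y => ?_, ?_, fun x => ?_⟩
    · simp only [LinearMap.comp_apply, LinearEquiv.coe_coe, h.symm_mul, hW, h.map_mul]
    · simp only [h.one, LinearMap.comp_apply, LinearEquiv.coe_coe,
        LinearEquiv.symm_apply_apply, bladeScale_eb, Finset.prod_empty, one_smul]
    · rw [← h.map_vec]
      simp only [LinearMap.comp_apply, LinearEquiv.coe_coe, LinearEquiv.symm_apply_apply]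
      rw [bladeScale_vec e _ (-1) (fun i => by simp), map_smul, neg_one_smul]
  refine ⟨_, hex, fun ρ' hρ' => hom_ext_of_equiv Φ (fun K => ?_)⟩
  obtain ⟨n, -, v, hv⟩ := h.exists_prod K
  rw [hv]
  exact hρ'.eq_on_prod hex n v

/-- The span of the blades of `r` elements, carried over along `Φ`. -/
def bladeSpan (Φ : (Finset M →₀ R) ≃ₗ[R] U) (r : ℤ) : Submodule R U :=
  Submodule.span R ((fun K => Φ (eb K)) '' {K : Finset M | (K.card : ℤ) = r})

theorem Represents.vec_mul_mem {e : Module.Basis M R V} {A : AlgStr R U}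
    {ι : V →ₗ[R] U} {Φ : (Finset M →₀ R) ≃ₗ[R] U} (h : Represents e (fun _ => 0) A ι Φ)
    (r : ℤ) (x : V) {X : U} (hX : X ∈ bladeSpan Φ r) : A.mul (ι x) X ∈ bladeSpan Φ (r + 1) := by
  have hx : x ∈ Submodule.span R (Set.range e) := by rw [e.span_eq]; trivial
  induction hx using Submodule.span_induction with
  | zero => simp
  | add y z _ _ hy hz => simpa using add_mem hy hz
  | smul a y _ hy => simpa using Submodule.smul_mem _ a hy
  | mem y hy =>
    obtain ⟨i, rfl⟩ := hy
    rw [← h.map_vec, bladeVec_basis]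
    induction hX using Submodule.span_induction with
    | zero => simp
    | add y z _ _ hy hz => simpa using add_mem hy hz
    | smul a y _ hy => simpa using Submodule.smul_mem _ a hy
    | mem y hy =>
      obtain ⟨K, hK, rfl⟩ := hy
      simp only
      rw [← h.map_mul, bladeMul_eb, map_smul]
      by_cases hi : i ∈ K
      · have h0 : sigma (fun _ : M => (0 : R)) {i} K = 0 := by
          rw [sigma, beta, Finset.singleton_inter_of_mem hi, Finset.prod_singleton, mul_zero]
        rw [h0, zero_smul]
        exact zero_mem _
      · refine Submodule.smul_mem _ _ (Submodule.subset_span ⟨_, ?_, rfl⟩)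
        have h1 : symmDiff {i} K = insert i K := by
          rw [Disjoint.symmDiff_eq_sup (by simpa using hi)]
          rfl
        have h2 : (K.card : ℤ) = r := hK
        simp only [Set.mem_ofPred_eq]
        rw [h1, Finset.card_insert_of_notMem hi]
        push_cast
        rw [h2]

theorem Represents.prod_mem {e : Module.Basis M R V} {A : AlgStr R U}
    {ι : V →ₗ[R] U} {Φ : (Finset M →₀ R) ≃ₗ[R] U} (h : Represents e (fun _ => 0) A ι Φ)
    (n : ℕ) (v : Fin n → V) : A.prod (fun i => ι (v i)) ∈ bladeSpan Φ n := by
  induction n with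
  | zero =>
    rw [A.prod_zero, h.one]
    exact Submodule.subset_span ⟨∅, by simp, rfl⟩
  | succ n ih =>
    rw [A.prod_succ]
    push_cast
    exact h.vec_mul_mem _ _ (ih (fun i => v i.succ))

theorem isCompl_bladeSpan (Φ : (Finset M →₀ R) ≃ₗ[R] U) (r : ℤ) :
    IsCompl (bladeSpan Φ r) (⨆ s : ℤ, ⨆ _ : s ≠ r, bladeSpan Φ s) := by
  have hb : ∀ K, Module.Basis.ofRepr Φ.symm K = Φ (eb K) := fun K => rfl
  have hsup : (⨆ s : ℤ, ⨆ _ : s ≠ r, bladeSpan Φ s) =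
      Submodule.span R ((fun K => Φ (eb K)) '' {K : Finset M | (K.card : ℤ) = r}ᶜ) := by
    apply le_antisymm
    · refine iSup₂_le (fun s hs => Submodule.span_mono (Set.image_mono ?_))
      intro K hK hK'
      exact hs (hK.symm.trans hK')
    · rw [Submodule.span_le]
      rintro _ ⟨K, hK, rfl⟩
      exact Submodule.mem_iSup_of_mem (K.card : ℤ)
        (Submodule.mem_iSup_of_mem hK (Submodule.subset_span ⟨K, rfl, rfl⟩))
  rw [hsup, bladeSpan]
  refine ⟨(Module.Basis.ofRepr Φ.symm).linearIndependent.disjoint_span_image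
    disjoint_compl_right, Submodule.codisjoint_span_image_of_codisjoint
    (v := Module.Basis.ofRepr Φ.symm) (Module.Basis.ofRepr Φ.symm).span_eq ?_⟩
  exact codisjoint_iff.mpr (Set.union_compl_self _)

end Represented

namespace GeometricAlgebra

variable {R M V U : Type*} [CommRing R] [LinearOrder M] [AddCommGroup V] [Module R V]
  [AddCommGroup U] [Module R U] {B : LinearMap.BilinForm R V} {e : Module.Basis M R V}

theorem represents_cl (G : GeometricAlgebra B e U) :
    Represents e (fun i => B (e i) (e i)) G.cl G.ι G.iso.toEquiv :=
  ⟨G.iso.map_cl, G.iso.map_ι⟩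

theorem represents_ext (G : GeometricAlgebra B e U) :
    Represents e (fun _ => 0) G.ext G.ι G.iso.toEquiv :=
  ⟨G.iso.map_ext, G.iso.map_ι⟩

theorem grade_eq (G : GeometricAlgebra B e U) (r : ℤ) :
    G.grade r = bladeSpan G.iso.toEquiv r := by
  apply le_antisymm
  · refine Submodule.span_le.mpr ?_
    rintro _ ⟨n, rfl, v, rfl⟩
    exact G.represents_ext.prod_mem n v
  · refine Submodule.span_le.mpr ?_
    rintro _ ⟨K, hK, rfl⟩
    obtain ⟨n, hn, v, hv⟩ := G.represents_ext.exists_prod K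
    exact Submodule.subset_span ⟨n, by rw [hn]; exact hK, v, hv⟩

theorem isCompl_grade (G : GeometricAlgebra B e U) (r : ℤ) :
    IsCompl (G.grade r) (⨆ s : ℤ, ⨆ _ : s ≠ r, G.grade s) := by
  simp only [grade_eq]
  exact isCompl_bladeSpan _ r

/-- `⟨X⟩_r`: the projection onto the subspace of grade `r` along the sum of the subspaces of
all other grades. -/
def gradeProj (G : GeometricAlgebra B e U) (r : ℤ) : U →ₗ[R] U :=
  (G.grade r).projection (⨆ s : ℤ, ⨆ _ : s ≠ r, G.grade s) (G.isCompl_grade r)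

/-- The reversion of the Clifford structure: the unique map with `IsReversion`. -/
def clRev (G : GeometricAlgebra B e U) : U →ₗ[R] U :=
  Classical.choose G.represents_cl.existsUnique_reversion

/-- The reversion of the Grassmann structure: the unique map with `IsReversion`. -/
def extRev (G : GeometricAlgebra B e U) : U →ₗ[R] U :=
  Classical.choose G.represents_ext.existsUnique_reversion

/-- The main automorphism `X ↦ X̂`: the unique map with `IsMainAut` for the Clifford
structure. -/
def hat (G : GeometricAlgebra B e U) : U →ₗ[R] U :=
  Classical.choose G.represents_cl.existsUnique_mainAut

/-- The scalar product `X ∗ Y`, carried over from the model. -/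
def scalar (G : GeometricAlgebra B e U) (X Y : U) : U :=
  G.iso.toEquiv (bladeScalar (fun i => B (e i) (e i))
    (G.iso.toEquiv.symm X) (G.iso.toEquiv.symm Y))

/-- The left contraction `X ⌋ Y`, carried over from the model. -/
def lc (G : GeometricAlgebra B e U) (X Y : U) : U :=
  G.iso.toEquiv (bladeLeft (fun i => B (e i) (e i))
    (G.iso.toEquiv.symm X) (G.iso.toEquiv.symm Y))

/-- The right contraction `X ⌊ Y`, carried over from the model. -/
def rc (G : GeometricAlgebra B e U) (X Y : U) : U :=
  G.iso.toEquiv (bladeRight (fun i => B (e i) (e i))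
    (G.iso.toEquiv.symm X) (G.iso.toEquiv.symm Y))

end GeometricAlgebra

end GeomAlg

end

/-!
The images `Φ e_K` of the blades, `Φ` the isomorphism from the model, form a basis, all products
in sight are (multi)linear, and on blades every one of them is either `0` or the Clifford product
`e_H e_K = σ(H, K) e_{H ∆ K}`: the outer product keeps it if `H` and `K` are disjoint, the
contractions if one index set contains the other, the scalar product if `H = K`. Hence most
identities compare two combinatorial conditions on finite sets.

* Grades: `#(H ∆ K) + 2 #(H ∩ K) = #H + #K` (`card_symmDiff_add`) shows that each condition picks
  out one grade of the Clifford product, and which grades can occur at all.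
* `(X ∧ Y) ⌋ Z = X ⌋ (Y ⌋ Z)`: on blades both sides are a triple Clifford product under equivalent
  conditions, so that associativity suffices.
* Reversion: a blade is the product, in either structure, of the same vectors in increasing order,
  and reversing the order costs the sign `(-1) ^ (n choose 2)` in both
  (`Represents.reversion_blade`).
* Derivation rules: contraction by `e_i` is `q i` times the signed removal of `i`, and this removal
  is an antiderivation of the product of *every* diagonal form (`sigma_antiderivation`), in
  particular of the Clifford and of the outer product (`GeometricAlgebra.lc_vec_mul`). The
  expansions of a contracted product of vectors follow by induction on the number of factors
  (`AlgStr.antiderivation_prod`).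
* For orthogonal vectors, `x X = x ∧ X + x ⌋ X` and the expansion of `x ⌋ X`, all of whose terms
  vanish, turn Clifford products into outer products one factor at a time.
-/

namespace GeomAlg

/-! ### Signs and reduction factors -/

section Signs

variable {R M : Type*} [CommRing R] [LinearOrder M]

theorem alpha_singleton_mul_alpha (i : M) (H : Finset M) :
    alpha R {i} H * alpha R H {i} = (-1) ^ H.card * if i ∈ H then -1 else 1 := by
  rw [alpha_eq, alpha_eq, Finset.prod_singleton]
  simp only [Finset.prod_singleton]
  rw [← Finset.prod_mul_distrib, ← Finset.prod_const,
    ← Finset.prod_ite_eq' H i (fun _ => (-1 : R)), ← Finset.prod_mul_distrib]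
  refine Finset.prod_congr rfl fun j _ => ?_
  rcases lt_trichotomy j i with h | h | h
  · simp [h, h.ne, h.not_gt]
  · simp [h]
  · simp [h, h.ne', h.not_gt]

theorem sigma_singleton_of_mem (q : M → R) {i : M} {K : Finset M} (h : i ∈ K) :
    sigma q {i} K = q i * alpha R {i} K := by
  rw [sigma, beta, Finset.singleton_inter_of_mem h, Finset.prod_singleton, mul_comm]

/-- The Grassmann sign of disjoint blades is their Clifford sign. -/
theorem sigma_zero (q : M → R) (H J : Finset M) :
    sigma (fun _ => 0) H J = if Disjoint H J then sigma q H J else 0 := by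
  split_ifs with h
  · simp [sigma, beta, Finset.disjoint_iff_inter_eq_empty.mp h]
  · obtain ⟨i, hi⟩ := Finset.nonempty_iff_ne_empty.mpr
      (fun h' => h (Finset.disjoint_iff_inter_eq_empty.mpr h'))
    rw [sigma, beta, Finset.prod_eq_zero hi rfl, mul_zero]

theorem beta_symmDiff_singleton_left (p : M → R) {i : M} {H J : Finset M} (hJ : i ∉ J) :
    beta p (symmDiff {i} H) J = beta p H J := by
  unfold beta
  congr 1
  ext a
  simp only [Finset.mem_inter, Finset.mem_symmDiff, Finset.mem_singleton]
  grind

theorem beta_symmDiff_singleton_right (p : M → R) {i : M} {H J : Finset M} (hH : i ∉ H) :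
    beta p H (symmDiff {i} J) = beta p H J := by
  rw [beta, Finset.inter_comm, ← beta, beta_symmDiff_singleton_left p hH, beta, beta,
    Finset.inter_comm]

theorem beta_symmDiff_singleton_of_mem (p : M → R) {i : M} {H J : Finset M} (hH : i ∈ H)
    (hJ : i ∈ J) : beta p (symmDiff {i} H) J = beta p H (symmDiff {i} J) := by
  unfold beta
  congr 1
  ext a
  simp only [Finset.mem_inter, Finset.mem_symmDiff, Finset.mem_singleton]
  grind

/-- The removal of `i`, with sign `alpha {i} K` and zero on blades without `i`, is an
antiderivation of the product of *every* diagonal form `p`: here, the identity between the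
coefficients of `e_{i} ∆ e_H ∆ e_J`. -/
theorem sigma_antiderivation (p : M → R) (i : M) (H J : Finset M) :
    (if i ∈ symmDiff H J then sigma p H J * alpha R {i} (symmDiff H J) else 0) =
      (if i ∈ H then alpha R {i} H * sigma p (symmDiff {i} H) J else 0) +
      (if i ∈ J then (-1) ^ H.card * (alpha R {i} J * sigma p H (symmDiff {i} J)) else 0) := by
  have h1 := alpha_singleton_mul_alpha (R := R) i H
  have h2 := alpha_sq (R := R) {i} H
  have h3 : ((-1 : R) ^ H.card) * (-1) ^ H.card = 1 := by
    rw [← mul_pow]; simp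
  have hHi : alpha R H {i} = alpha R {i} H * ((-1) ^ H.card * if i ∈ H then -1 else 1) := by
    rw [← h1, ← mul_assoc, h2, one_mul]
  by_cases hH : i ∈ H <;> by_cases hJ : i ∈ J
  · rw [if_neg (by simp [Finset.mem_symmDiff, hH, hJ]), if_pos hH, if_pos hJ]
    simp only [sigma, alpha_symmDiff_left, alpha_symmDiff_right, hHi, if_pos hH,
      beta_symmDiff_singleton_of_mem p hH hJ]
    linear_combination (alpha R {i} H * alpha R {i} J * alpha R H J *
      beta p H (symmDiff {i} J)) * h3
  · rw [if_pos (by simp [Finset.mem_symmDiff, hH, hJ]), if_pos hH, if_neg hJ]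
    simp only [sigma, alpha_symmDiff_left, alpha_symmDiff_right,
      beta_symmDiff_singleton_left p hJ]
    ring
  · rw [if_pos (by simp [Finset.mem_symmDiff, hH, hJ]), if_neg hH, if_pos hJ]
    simp only [sigma, alpha_symmDiff_right, hHi, if_neg hH,
      beta_symmDiff_singleton_right p hH]
    linear_combination (-alpha R {i} H * alpha R {i} J * alpha R H J * beta p H J) * h3
  · rw [if_neg (by simp [Finset.mem_symmDiff, hH, hJ]), if_neg hH, if_neg hJ, add_zero]

theorem card_symmDiff_add (H J : Finset M) :
    (symmDiff H J).card + 2 * (H ∩ J).card = H.card + J.card := by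
  have h1 : (symmDiff H J).card = (H \ J).card + (J \ H).card := by
    rw [symmDiff_def, Finset.sup_eq_union]
    exact Finset.card_union_of_disjoint disjoint_sdiff_sdiff
  have h2 := Finset.card_sdiff_add_card_inter H J
  have h3 := Finset.card_sdiff_add_card_inter J H
  rw [Finset.inter_comm] at h3
  omega

theorem card_inter_eq_left_iff (H J : Finset M) : (H ∩ J).card = H.card ↔ H ⊆ J := by
  rw [← Finset.inter_eq_left]
  exact ⟨fun h => Finset.eq_of_subset_of_card_le Finset.inter_subset_left h.ge,
    fun h => by rw [h]⟩

end Signs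

/-! ### Reduction to blades and basis vectors -/

section Induction

variable {R M V U : Type*} [CommRing R] [AddCommGroup V] [Module R V] [AddCommGroup U] [Module R U]

/-- A property that is stable under linear combinations holds everywhere if it holds on
blades. -/
theorem blade_induction (Φ : (Finset M →₀ R) ≃ₗ[R] U) {P : U → Prop}
    (add : ∀ X Y, P X → P Y → P (X + Y)) (smul : ∀ (a : R) X, P X → P (a • X))
    (blade : ∀ K, P (Φ (eb K))) (X : U) : P X := by
  have h0 : P 0 := by simpa using smul 0 _ (blade ∅)
  have h : ∀ Y, P (Φ Y) := fun Y => by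
    induction Y using Finsupp.induction_linear with
    | zero => simpa using h0
    | add f g hf hg => simpa using add _ _ hf hg
    | single K a => simpa [eb, ← map_smul] using smul a _ (blade K)
  simpa using h (Φ.symm X)

/-- An identity that is linear in a vector may be checked on the basis. -/
theorem vec_induction (e : Module.Basis M R V) {P : V → Prop} (zero : P 0)
    (add : ∀ x y, P x → P y → P (x + y)) (smul : ∀ (a : R) x, P x → P (a • x))
    (basis : ∀ i, P (e i)) (x : V) : P x := by
  have hx : x ∈ Submodule.span R (Set.range e) := by rw [e.span_eq]; trivial
  induction hx using Submodule.span_induction with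
  | zero => exact zero
  | add y z _ _ hy hz => exact add y z hy hz
  | smul a y _ hy => exact smul a y hy
  | mem y hy =>
    obtain ⟨i, rfl⟩ := hy
    exact basis i

end Induction

/-! ### Reversion and main automorphism on blades -/

section Represented

variable {R M V U : Type*} [CommRing R] [LinearOrder M] [AddCommGroup V] [Module R V]
  [AddCommGroup U] [Module R U] {e : Module.Basis M R V} {q : M → R} {A : AlgStr R U}
  {ι : V →ₗ[R] U} {Φ : (Finset M →₀ R) ≃ₗ[R] U}

theorem Represents.mul_blade (h : Represents e q A ι Φ) (H J : Finset M) :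
    A.mul (Φ (eb H)) (Φ (eb J)) = sigma q H J • Φ (eb (symmDiff H J)) := by
  rw [← h.map_mul, bladeMul_eb, map_smul]

/-- A reversion multiplies a blade of `n` elements by `(-1) ^ (n choose 2)`, whatever the
form `q`. -/
theorem Represents.reversion_blade (h : Represents e q A ι Φ) {ρ : U →ₗ[R] U}
    (hρ : IsReversion A ι ρ) (K : Finset M) :
    ρ (Φ (eb K)) = (-1 : R) ^ (K.card.choose 2) • Φ (eb K) := by
  induction K using Finset.induction_on_min with
  | empty => rw [← h.one, hρ.map_one]; simp
  | insert a s ha ih =>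
    have has : a ∉ s := fun h => lt_irrefl _ (ha a h)
    have h1 : alpha R {a} s = 1 := by
      rw [alpha_eq, Finset.prod_singleton]
      exact Finset.prod_eq_one (fun j hj => if_neg (not_lt.mpr (ha j hj).le))
    have h2 := alpha_singleton_mul_alpha (R := R) a s
    rw [h1, one_mul, if_neg has, mul_one] at h2
    have h3 : symmDiff s {a} = insert a s := by
      rw [symmDiff_comm, Disjoint.symmDiff_eq_sup (by simpa using has)]
      rfl
    have h4 : beta q s {a} = 1 := by
      rw [beta, Finset.inter_singleton_of_notMem has, Finset.prod_empty]
    rw [← bladeMul_insert q ha, h.map_mul, hρ.map_mul, ih, ← bladeVec_basis e, h.map_vec,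
      hρ.map_vec, ← h.map_vec, bladeVec_basis, map_smul, LinearMap.smul_apply, ← h.map_mul,
      ← h.map_mul, bladeMul_insert q ha, bladeMul_eb, sigma, h2, h3, h4, mul_one, map_smul,
      smul_smul, Finset.card_insert_of_notMem has, Nat.choose_succ_succ', Nat.choose_one_right,
      pow_add, mul_comm]

theorem Represents.mainAut_blade (h : Represents e q A ι Φ) {φ : U →ₗ[R] U}
    (hφ : IsMainAut A ι φ) (K : Finset M) :
    φ (Φ (eb K)) = (-1 : R) ^ K.card • Φ (eb K) := by
  induction K using Finset.induction_on_min with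
  | empty => rw [← h.one, hφ.map_one]; simp
  | insert a s ha ih =>
    have has : a ∉ s := fun h => lt_irrefl _ (ha a h)
    rw [← bladeMul_insert q ha, h.map_mul, hφ.map_mul, ih, ← bladeVec_basis e, h.map_vec,
      hφ.map_vec, map_smul, map_neg, LinearMap.neg_apply, Finset.card_insert_of_notMem has,
      pow_succ, mul_neg_one, neg_smul, smul_neg]

end Represented

/-! ### Ordered products -/

section Products

variable {R U : Type*} [CommRing R] [AddCommGroup U] [Module R U]

theorem AlgStr.prod_eq_zero (A : AlgStr R U) {n : ℕ} (f : Fin n → U) (k : Fin n)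
    (hk : f k = 0) : A.prod f = 0 := by
  induction n with
  | zero => exact k.elim0
  | succ n ih =>
    rw [A.prod_succ]
    cases k using Fin.cases with
    | zero => rw [hk, map_zero, LinearMap.zero_apply]
    | succ k => rw [ih (fun i => f i.succ) k hk, map_zero]

/-- The expansion of an antiderivation `d` on an ordered product of elements that change sign
under the grade involution `φ`. -/
theorem AlgStr.antiderivation_prod (A : AlgStr R U) {d φ : U →ₗ[R] U} (hone : d A.one = 0)
    (hmul : ∀ X Y, d (A.mul X Y) = A.mul (d X) Y + A.mul (φ X) (d Y)) {n : ℕ} (f : Fin n → U)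
    (hf : ∀ i, φ (f i) = -f i) :
    d (A.prod f) = ∑ k : Fin n, (-1 : R) ^ (k : ℕ) •
      A.prod (Function.update f k (d (f k))) := by
  induction n with
  | zero => simp [A.prod_zero, hone]
  | succ n ih =>
    have h0 : ∀ k : Fin n, (fun i : Fin n => Function.update f k.succ (d (f k.succ)) i.succ) =
        Function.update (fun i => f i.succ) k (d (f k.succ)) := by
      intro k
      funext i
      simp [Function.update_apply]
    rw [A.prod_succ, hmul, hf, ih (fun i => f i.succ) (fun i => hf i.succ), Fin.sum_univ_succ]
    congr 1
    · simp [A.prod_succ]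
    · rw [map_sum]
      refine Finset.sum_congr rfl fun k _ => ?_
      rw [A.prod_succ, h0, Function.update_of_ne (Fin.succ_ne_zero k).symm, map_smul,
        Fin.val_succ, pow_succ, mul_neg_one, map_neg, LinearMap.neg_apply, smul_neg, neg_smul]

end Products

namespace GeometricAlgebra

variable {R M V U : Type*} [CommRing R] [LinearOrder M] [AddCommGroup V] [Module R V]
  [AddCommGroup U] [Module R U] {B : LinearMap.BilinForm R V} {e : Module.Basis M R V}

theorem ι_basis (G : GeometricAlgebra B e U) (i : M) : G.ι (e i) = G.iso.toEquiv (eb {i}) := by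
  rw [← G.represents_cl.map_vec, bladeVec_basis]

theorem isReversion_clRev (G : GeometricAlgebra B e U) : IsReversion G.cl G.ι G.clRev :=
  (Classical.choose_spec G.represents_cl.existsUnique_reversion).1

theorem isReversion_extRev (G : GeometricAlgebra B e U) : IsReversion G.ext G.ι G.extRev :=
  (Classical.choose_spec G.represents_ext.existsUnique_reversion).1

theorem isMainAut_hat (G : GeometricAlgebra B e U) : IsMainAut G.cl G.ι G.hat :=
  (Classical.choose_spec G.represents_cl.existsUnique_mainAut).1

theorem cl_one_eq_ext_one (G : GeometricAlgebra B e U) : G.cl.one = G.ext.one := by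
  rw [G.represents_cl.one, G.represents_ext.one]

/-! ### Bilinearity and values on blades -/

/-- The left contraction as a bilinear map. -/
noncomputable def lcHom (G : GeometricAlgebra B e U) : U →ₗ[R] U →ₗ[R] U :=
  ((bladeLeft (fun i => B (e i) (e i))).compl₁₂ G.iso.toEquiv.symm.toLinearMap
    G.iso.toEquiv.symm.toLinearMap).compr₂ G.iso.toEquiv.toLinearMap

/-- The right contraction as a bilinear map. -/
noncomputable def rcHom (G : GeometricAlgebra B e U) : U →ₗ[R] U →ₗ[R] U :=
  ((bladeRight (fun i => B (e i) (e i))).compl₁₂ G.iso.toEquiv.symm.toLinearMap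
    G.iso.toEquiv.symm.toLinearMap).compr₂ G.iso.toEquiv.toLinearMap

/-- The scalar product as a bilinear map. -/
noncomputable def scalarHom (G : GeometricAlgebra B e U) : U →ₗ[R] U →ₗ[R] U :=
  ((bladeScalar (fun i => B (e i) (e i))).compl₁₂ G.iso.toEquiv.symm.toLinearMap
    G.iso.toEquiv.symm.toLinearMap).compr₂ G.iso.toEquiv.toLinearMap

theorem lc_eq (G : GeometricAlgebra B e U) (X Y : U) : G.lc X Y = G.lcHom X Y := rfl

theorem rc_eq (G : GeometricAlgebra B e U) (X Y : U) : G.rc X Y = G.rcHom X Y := rfl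

theorem scalar_eq (G : GeometricAlgebra B e U) (X Y : U) : G.scalar X Y = G.scalarHom X Y := rfl

theorem lcHom_blade (G : GeometricAlgebra B e U) (H K : Finset M) :
    G.lcHom (G.iso.toEquiv (eb H)) (G.iso.toEquiv (eb K)) =
      if H ⊆ K then G.cl.mul (G.iso.toEquiv (eb H)) (G.iso.toEquiv (eb K)) else 0 := by
  rw [← G.represents_cl.map_mul, ← lc_eq, lc, LinearEquiv.symm_apply_apply,
    LinearEquiv.symm_apply_apply, bladeLeft, onBlades_eb, apply_ite G.iso.toEquiv, map_zero]

theorem rcHom_blade (G : GeometricAlgebra B e U) (H K : Finset M) :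
    G.rcHom (G.iso.toEquiv (eb H)) (G.iso.toEquiv (eb K)) =
      if K ⊆ H then G.cl.mul (G.iso.toEquiv (eb H)) (G.iso.toEquiv (eb K)) else 0 := by
  rw [← G.represents_cl.map_mul, ← rc_eq, rc, LinearEquiv.symm_apply_apply,
    LinearEquiv.symm_apply_apply, bladeRight, onBlades_eb, apply_ite G.iso.toEquiv, map_zero]

theorem scalarHom_blade (G : GeometricAlgebra B e U) (H K : Finset M) :
    G.scalarHom (G.iso.toEquiv (eb H)) (G.iso.toEquiv (eb K)) =
      if H = K then G.cl.mul (G.iso.toEquiv (eb H)) (G.iso.toEquiv (eb K)) else 0 := by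
  rw [← G.represents_cl.map_mul, ← scalar_eq, scalar, LinearEquiv.symm_apply_apply,
    LinearEquiv.symm_apply_apply, bladeScalar, onBlades_eb, apply_ite G.iso.toEquiv, map_zero]

theorem ext_mul_blade (G : GeometricAlgebra B e U) (H K : Finset M) :
    G.ext.mul (G.iso.toEquiv (eb H)) (G.iso.toEquiv (eb K)) =
      if Disjoint H K then G.cl.mul (G.iso.toEquiv (eb H)) (G.iso.toEquiv (eb K)) else 0 := by
  rw [G.represents_cl.mul_blade, G.represents_ext.mul_blade,
    sigma_zero (fun i => B (e i) (e i)), ite_smul, zero_smul]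

theorem blade_mem_grade (G : GeometricAlgebra B e U) (K : Finset M) :
    G.iso.toEquiv (eb K) ∈ G.grade K.card := by
  rw [grade_eq]
  exact Submodule.subset_span ⟨K, rfl, rfl⟩

theorem gradeProj_blade (G : GeometricAlgebra B e U) (r : ℤ) (K : Finset M) :
    G.gradeProj r (G.iso.toEquiv (eb K)) =
      if (K.card : ℤ) = r then G.iso.toEquiv (eb K) else 0 := by
  split_ifs with h
  · subst h
    exact Submodule.projection_apply_left (G.isCompl_grade _) ⟨_, G.blade_mem_grade K⟩
  · refine (Submodule.projection_apply_eq_zero_iff (G.isCompl_grade r)).mpr ?_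
    exact Submodule.mem_iSup_of_mem (K.card : ℤ)
      (Submodule.mem_iSup_of_mem h (G.blade_mem_grade K))

theorem grade_induction (G : GeometricAlgebra B e U) {r : ℤ} {P : U → Prop} (zero : P 0)
    (add : ∀ X Y, P X → P Y → P (X + Y)) (smul : ∀ (a : R) X, P X → P (a • X))
    (blade : ∀ K : Finset M, (K.card : ℤ) = r → P (G.iso.toEquiv (eb K))) {X : U}
    (hX : X ∈ G.grade r) : P X := by
  rw [grade_eq] at hX
  induction hX using Submodule.span_induction with
  | zero => exact zero
  | add Y Z _ _ hY hZ => exact add Y Z hY hZ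
  | smul a Y _ hY => exact smul a Y hY
  | mem Y hY =>
    obtain ⟨K, hK, rfl⟩ := hY
    exact blade K hK

/-! ### Reversion -/

theorem clRev_eq_extRev (G : GeometricAlgebra B e U) : G.clRev = G.extRev :=
  hom_ext_of_equiv G.iso.toEquiv fun K => by
    rw [G.represents_cl.reversion_blade G.isReversion_clRev,
      G.represents_ext.reversion_blade G.isReversion_extRev]

theorem clRev_of_mem_grade (G : GeometricAlgebra B e U) (r : ℤ) (X : U) (hX : X ∈ G.grade r) :
    G.clRev X = ((-1 : ℤˣ) ^ (r * (r - 1) / 2)) • X := by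
  refine G.grade_induction (P := fun X => G.clRev X = ((-1 : ℤˣ) ^ (r * (r - 1) / 2)) • X)
    ?_ (fun X Y hX hY => ?_) (fun a X hX => ?_) (fun K hK => ?_) hX
  · simp
  · rw [map_add, hX, hY, smul_add]
  · rw [map_smul, hX, smul_comm]
  · have h : r * (r - 1) / 2 = (K.card.choose 2 : ℕ) := by
      rw [Nat.choose_two_right, ← hK]
      cases K.card with
      | zero => simp
      | succ n => push_cast; simp
    rw [G.represents_cl.reversion_blade G.isReversion_clRev, h, zpow_natCast]
    rcases Nat.even_or_odd (K.card.choose 2) with h | h <;> simp [h.neg_one_pow]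

theorem clRev_rc (G : GeometricAlgebra B e U) (X Y : U) :
    G.clRev (G.rc X Y) = G.lc (G.clRev Y) (G.clRev X) := by
  simp only [rc_eq, lc_eq]
  induction X using blade_induction G.iso.toEquiv with
  | add X X' h h' => simp only [map_add, LinearMap.add_apply, h, h']
  | smul a X h => simp only [map_smul, LinearMap.smul_apply, h]
  | blade H =>
    induction Y using blade_induction G.iso.toEquiv with
    | add Y Y' h h' => simp only [map_add, LinearMap.add_apply, h, h']
    | smul a Y h => simp only [map_smul, LinearMap.smul_apply, h]
    | blade K =>
      rw [rcHom_blade]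
      split_ifs with h
      · rw [G.isReversion_clRev.map_mul]
        simp only [G.represents_cl.reversion_blade G.isReversion_clRev, map_smul,
          LinearMap.smul_apply, lcHom_blade, if_pos h]
      · simp only [G.represents_cl.reversion_blade G.isReversion_clRev, map_smul,
          LinearMap.smul_apply, lcHom_blade, if_neg h, smul_zero, map_zero]

/-! ### Grades of products -/

theorem gradeProj_cl_mul_blade (G : GeometricAlgebra B e U) (r : ℤ) (H K : Finset M) :
    G.gradeProj r (G.cl.mul (G.iso.toEquiv (eb H)) (G.iso.toEquiv (eb K))) =
      if ((symmDiff H K).card : ℤ) = r then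
        G.cl.mul (G.iso.toEquiv (eb H)) (G.iso.toEquiv (eb K)) else 0 := by
  rw [G.represents_cl.mul_blade, map_smul, gradeProj_blade, smul_ite, smul_zero]

theorem scalar_eq_gradeProj (G : GeometricAlgebra B e U) (X Y : U) :
    G.scalar X Y = G.gradeProj 0 (G.cl.mul X Y) := by
  rw [scalar_eq]
  induction X using blade_induction G.iso.toEquiv with
  | add X X' h h' => simp only [map_add, LinearMap.add_apply, h, h']
  | smul a X h => simp only [map_smul, LinearMap.smul_apply, h]
  | blade H =>
    induction Y using blade_induction G.iso.toEquiv with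
    | add Y Y' h h' => simp only [map_add, h, h']
    | smul a Y h => simp only [map_smul, h]
    | blade K =>
      rw [scalarHom_blade, gradeProj_cl_mul_blade]
      refine if_congr ?_ rfl rfl
      rw [Nat.cast_eq_zero, Finset.card_eq_zero, ← Finset.bot_eq_empty, symmDiff_eq_bot]

/-- A bilinear identity between elements of fixed grades may be checked on blades. -/
theorem grade_bilinear_ext (G : GeometricAlgebra B e U) {f g : U →ₗ[R] U →ₗ[R] U} {r s : ℤ}
    (h : ∀ H K : Finset M, (H.card : ℤ) = r → (K.card : ℤ) = s →
      f (G.iso.toEquiv (eb H)) (G.iso.toEquiv (eb K)) =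
        g (G.iso.toEquiv (eb H)) (G.iso.toEquiv (eb K)))
    {X Y : U} (hX : X ∈ G.grade r) (hY : Y ∈ G.grade s) : f X Y = g X Y := by
  refine G.grade_induction (P := fun X => f X Y = g X Y) ?_ (fun X X' h h' => ?_)
    (fun a X h => ?_) (fun H hH => ?_) hX
  · simp
  · simp only [map_add, LinearMap.add_apply, h, h']
  · simp only [map_smul, LinearMap.smul_apply, h]
  · refine G.grade_induction (P := fun Y => f (G.iso.toEquiv (eb H)) Y =
      g (G.iso.toEquiv (eb H)) Y) ?_ (fun Y Y' h h' => ?_) (fun a Y h => ?_)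
      (fun K hK => h H K hH hK) hY
    · simp
    · simp only [map_add, h, h']
    · simp only [map_smul, h]

theorem ext_mul_eq_gradeProj (G : GeometricAlgebra B e U) {r s : ℤ} {X Y : U}
    (hX : X ∈ G.grade r) (hY : Y ∈ G.grade s) :
    G.ext.mul X Y = G.gradeProj (r + s) (G.cl.mul X Y) := by
  refine G.grade_bilinear_ext (g := G.cl.mul.compr₂ (G.gradeProj (r + s)))
    (fun H K hH hK => ?_) hX hY
  rw [LinearMap.compr₂_apply, gradeProj_cl_mul_blade, ext_mul_blade]
  refine if_congr ?_ rfl rfl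
  have := card_symmDiff_add H K
  rw [Finset.disjoint_iff_inter_eq_empty, ← Finset.card_eq_zero]
  omega

theorem lc_eq_gradeProj (G : GeometricAlgebra B e U) {r s : ℤ} {X Y : U}
    (hX : X ∈ G.grade r) (hY : Y ∈ G.grade s) :
    G.lc X Y = G.gradeProj (s - r) (G.cl.mul X Y) := by
  refine G.grade_bilinear_ext (f := G.lcHom) (g := G.cl.mul.compr₂ (G.gradeProj (s - r)))
    (fun H K hH hK => ?_) hX hY
  rw [LinearMap.compr₂_apply, gradeProj_cl_mul_blade, lcHom_blade]
  refine if_congr ?_ rfl rfl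
  have := card_symmDiff_add H K
  rw [← card_inter_eq_left_iff]
  omega

theorem rc_eq_gradeProj (G : GeometricAlgebra B e U) {r s : ℤ} {X Y : U}
    (hX : X ∈ G.grade r) (hY : Y ∈ G.grade s) :
    G.rc X Y = G.gradeProj (r - s) (G.cl.mul X Y) := by
  refine G.grade_bilinear_ext (f := G.rcHom) (g := G.cl.mul.compr₂ (G.gradeProj (r - s)))
    (fun H K hH hK => ?_) hX hY
  rw [LinearMap.compr₂_apply, gradeProj_cl_mul_blade, rcHom_blade]
  refine if_congr ?_ rfl rfl
  have := card_symmDiff_add H K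
  rw [← card_inter_eq_left_iff, Finset.inter_comm]
  omega

theorem cl_mul_eq_sum_gradeProj (G : GeometricAlgebra B e U) {r s : ℤ} {X Y : U}
    (hX : X ∈ G.grade r) (hY : Y ∈ G.grade s) :
    G.cl.mul X Y = ∑ i ∈ (Finset.Icc |r - s| (r + s)).filter (fun i => 2 ∣ i - |r - s|),
      G.gradeProj i (G.cl.mul X Y) := by
  have key := G.grade_bilinear_ext (f := G.cl.mul) (g := G.cl.mul.compr₂
    (∑ i ∈ (Finset.Icc |r - s| (r + s)).filter (fun i => 2 ∣ i - |r - s|), G.gradeProj i))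
    (fun H K hH hK => ?_) hX hY
  · rwa [LinearMap.compr₂_apply, LinearMap.sum_apply] at key
  · rw [LinearMap.compr₂_apply, LinearMap.sum_apply]
    simp only [gradeProj_cl_mul_blade]
    rw [Finset.sum_ite_eq, if_pos]
    have h1 := card_symmDiff_add H K
    have h2 := Finset.card_le_card (Finset.inter_subset_left (s₁ := H) (s₂ := K))
    have h3 := Finset.card_le_card (Finset.inter_subset_right (s₁ := H) (s₂ := K))
    rw [Finset.mem_filter, Finset.mem_Icc]
    rcases abs_cases (r - s) with ⟨h, _⟩ | ⟨h, _⟩ <;> rw [h] <;> omega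

/-! ### Contractions -/

theorem lc_ext_mul (G : GeometricAlgebra B e U) (X Y Z : U) :
    G.lc (G.ext.mul X Y) Z = G.lc X (G.lc Y Z) := by
  simp only [lc_eq]
  induction X using blade_induction G.iso.toEquiv with
  | add X X' h h' => simp only [map_add, LinearMap.add_apply, h, h']
  | smul a X h => simp only [map_smul, LinearMap.smul_apply, h]
  | blade H =>
    induction Y using blade_induction G.iso.toEquiv with
    | add Y Y' h h' => simp only [map_add, LinearMap.add_apply, h, h']
    | smul a Y h => simp only [map_smul, LinearMap.smul_apply, h]
    | blade J =>
      induction Z using blade_induction G.iso.toEquiv with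
      | add Z Z' h h' => simp only [map_add, h, h']
      | smul a Z h => simp only [map_smul, h]
      | blade K =>
        have hiff : (Disjoint H J ∧ symmDiff H J ⊆ K) ↔ (J ⊆ K ∧ H ⊆ symmDiff J K) := by
          simp only [Finset.disjoint_left, Finset.subset_iff, Finset.mem_symmDiff]
          grind
        have hl : G.lcHom (G.ext.mul (G.iso.toEquiv (eb H)) (G.iso.toEquiv (eb J)))
            (G.iso.toEquiv (eb K)) = if Disjoint H J ∧ symmDiff H J ⊆ K then
              G.cl.mul (G.cl.mul (G.iso.toEquiv (eb H)) (G.iso.toEquiv (eb J)))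
                (G.iso.toEquiv (eb K)) else 0 := by
          rw [ext_mul_blade, ite_and]
          split_ifs
          all_goals simp [G.represents_cl.mul_blade H J, lcHom_blade, *]
        have hr : G.lcHom (G.iso.toEquiv (eb H))
            (G.lcHom (G.iso.toEquiv (eb J)) (G.iso.toEquiv (eb K))) =
              if J ⊆ K ∧ H ⊆ symmDiff J K then
              G.cl.mul (G.iso.toEquiv (eb H)) (G.cl.mul (G.iso.toEquiv (eb J))
                (G.iso.toEquiv (eb K))) else 0 := by
          rw [lcHom_blade G J K, ite_and]
          split_ifs
          all_goals simp [G.represents_cl.mul_blade J K, lcHom_blade, *]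
        rw [hl, hr, G.cl.mul_assoc]
        exact if_congr hiff rfl rfl

theorem cl_vec_mul (G : GeometricAlgebra B e U) (x : V) (X : U) :
    G.cl.mul (G.ι x) X = G.ext.mul (G.ι x) X + G.lc (G.ι x) X := by
  rw [lc_eq]
  induction x using vec_induction e with
  | zero => simp
  | add x y h h' => simp only [map_add, LinearMap.add_apply, h, h']; abel
  | smul a x h => simp only [map_smul, LinearMap.smul_apply, h, smul_add]
  | basis i =>
    rw [ι_basis]
    induction X using blade_induction G.iso.toEquiv with
    | add X Y h h' => simp only [map_add, h, h']; abel
    | smul a X h => simp only [map_smul, h, smul_add]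
    | blade K =>
      rw [ext_mul_blade, lcHom_blade]
      simp only [Finset.disjoint_singleton_left, Finset.singleton_subset_iff]
      by_cases h : i ∈ K <;> simp [h]

theorem lc_vec_vec (hB : ∀ i j, i ≠ j → B (e i) (e j) = 0) (G : GeometricAlgebra B e U)
    (x y : V) : G.lc (G.ι x) (G.ι y) = B x y • G.ext.one := by
  rw [lc_eq]
  induction x using vec_induction e with
  | zero => simp
  | add x y h h' => simp only [map_add, LinearMap.add_apply, h, h', add_smul]
  | smul a x h => simp only [map_smul, LinearMap.smul_apply, h, smul_assoc]
  | basis i =>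
    induction y using vec_induction e with
    | zero => simp
    | add x y h h' => simp only [map_add, h, h', add_smul]
    | smul a x h => simp only [map_smul, h, smul_assoc]
    | basis j =>
      rw [ι_basis, ι_basis, lcHom_blade]
      simp only [Finset.singleton_subset_iff, Finset.mem_singleton]
      split_ifs with h
      · subst h
        rw [G.represents_cl.mul_blade, symmDiff_self, Finset.bot_eq_empty,
          G.represents_ext.one]
        simp [sigma, alpha_eq, beta]
      · rw [hB i j h, zero_smul]

theorem lcHom_basis_blade (G : GeometricAlgebra B e U) (i : M) (K : Finset M) :
    G.lcHom (G.ι (e i)) (G.iso.toEquiv (eb K)) =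
      B (e i) (e i) • (if i ∈ K then alpha R {i} K else 0) •
        G.iso.toEquiv (eb (symmDiff {i} K)) := by
  rw [ι_basis, lcHom_blade]
  simp only [Finset.singleton_subset_iff]
  split_ifs with h
  · rw [G.represents_cl.mul_blade, sigma_singleton_of_mem _ h, mul_smul]
  · rw [zero_smul, smul_zero]

/-- Contraction by a vector is an antiderivation of the algebra of every diagonal form `p` on
the same blades; only `p = q` and `p = 0` matter below. -/
theorem lc_vec_mul (G : GeometricAlgebra B e U) {p : M → R} {A : AlgStr R U}
    (h : Represents e p A G.ι G.iso.toEquiv) (x : V) (X Y : U) :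
    G.lcHom (G.ι x) (A.mul X Y) =
      A.mul (G.lcHom (G.ι x) X) Y + A.mul (G.hat X) (G.lcHom (G.ι x) Y) := by
  induction x using vec_induction e with
  | zero => simp
  | add x y h h' => simp only [map_add, LinearMap.add_apply, h, h']; abel
  | smul a x h => simp only [map_smul, LinearMap.smul_apply, h, smul_add]
  | basis i =>
    induction X using blade_induction G.iso.toEquiv with
    | add X X' h h' => simp only [map_add, LinearMap.add_apply, h, h']; abel
    | smul a X h => simp only [map_smul, LinearMap.smul_apply, h, smul_add]
    | blade H =>
      induction Y using blade_induction G.iso.toEquiv with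
      | add Y Y' h h' => simp only [map_add, h, h']; abel
      | smul a Y h => simp only [map_smul, h, smul_add]
      | blade J =>
        have key := sigma_antiderivation p i H J
        rw [G.represents_cl.mainAut_blade G.isMainAut_hat, h.mul_blade]
        simp only [map_smul, LinearMap.smul_apply, lcHom_basis_blade, h.mul_blade]
        have h1 : symmDiff {i} (symmDiff H J) = symmDiff (symmDiff {i} H) J :=
          (symmDiff_assoc _ _ _).symm
        have h2 : symmDiff H (symmDiff {i} J) = symmDiff (symmDiff {i} H) J := by
          rw [← symmDiff_assoc, symmDiff_comm H]
        rw [h1, h2]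
        simp only [smul_smul, ← add_smul]
        congr 1
        simp only [mul_ite, ite_mul, mul_zero, zero_mul] at key ⊢
        split_ifs at key ⊢ <;> linear_combination B (e i) (e i) * key

theorem lc_vec_prod (G : GeometricAlgebra B e U) {p : M → R} {A : AlgStr R U}
    (h : Represents e p A G.ι G.iso.toEquiv) (x : V) (n : ℕ) (v : Fin n → V) :
    G.lc (G.ι x) (A.prod (fun i => G.ι (v i))) =
      ∑ k : Fin n, (-1 : R) ^ (k : ℕ) •
        A.prod (Function.update (fun i => G.ι (v i)) k (G.lc (G.ι x) (G.ι (v k)))) := by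
  refine A.antiderivation_prod (d := G.lcHom (G.ι x)) ?_ (G.lc_vec_mul h x) _
    (fun i => G.isMainAut_hat.map_vec _)
  rw [h.one]
  induction x using vec_induction e with
  | zero => simp
  | add x y h h' => simp only [map_add, LinearMap.add_apply, h, h', add_zero]
  | smul a x h => simp only [map_smul, LinearMap.smul_apply, h, smul_zero]
  | basis i => simp [lcHom_basis_blade]

theorem cl_prod_eq_ext_prod (hB : ∀ i j, i ≠ j → B (e i) (e j) = 0)
    (G : GeometricAlgebra B e U) (n : ℕ) (v : Fin n → V)
    (hv : ∀ i j, i ≠ j → B (v i) (v j) = 0) :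
    G.cl.prod (fun i => G.ι (v i)) = G.ext.prod (fun i => G.ι (v i)) := by
  induction n with
  | zero => rw [AlgStr.prod_zero, AlgStr.prod_zero, cl_one_eq_ext_one]
  | succ n ih =>
    rw [AlgStr.prod_succ, AlgStr.prod_succ,
      ih (fun i => v i.succ) (fun i j hij => hv _ _ (by simpa using hij)), cl_vec_mul,
      G.lc_vec_prod G.represents_ext, Finset.sum_eq_zero, add_zero]
    intro k _
    rw [AlgStr.prod_eq_zero _ _ k, smul_zero]
    rw [Function.update_self, lc_vec_vec hB, hv _ _ (Fin.succ_ne_zero k).symm, zero_smul]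

end GeometricAlgebra

end GeomAlg

theorem theorem3 {R M V U : Type*} [CommRing R] [LinearOrder M] [AddCommGroup V] [Module R V]
    [AddCommGroup U] [Module R U] (B : LinearMap.BilinForm R V) (e : Module.Basis M R V)
    (hB : ∀ i j, i ≠ j → B (e i) (e j) = 0) (G : GeomAlg.GeometricAlgebra B e U) :
    -- (1)
    (G.cl.one = G.ext.one ∧
      ∀ (x : V) (X : U), G.cl.mul (G.ι x) X = G.ext.mul (G.ι x) X + G.lc (G.ι x) X) ∧
    -- (2)
    (G.clRev = G.extRev ∧
      ∀ (r : ℤ), ∀ X ∈ G.grade r, G.clRev X = ((-1 : ℤˣ) ^ (r * (r - 1) / 2)) • X) ∧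
    -- (3a) and (3b)
    ((∀ X Y : U, G.clRev (G.rc X Y) = G.lc (G.clRev Y) (G.clRev X)) ∧
      (∀ X Y : U, G.scalar X Y = G.gradeProj 0 (G.cl.mul X Y)) ∧
      (∀ r s : ℤ, ∀ X ∈ G.grade r, ∀ Y ∈ G.grade s,
        G.ext.mul X Y = G.gradeProj (r + s) (G.cl.mul X Y) ∧
        G.lc X Y = G.gradeProj (s - r) (G.cl.mul X Y) ∧
        G.rc X Y = G.gradeProj (r - s) (G.cl.mul X Y) ∧
        G.cl.mul X Y = ∑ i ∈ (Finset.Icc |r - s| (r + s)).filter (fun i => 2 ∣ i - |r - s|),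
          G.gradeProj i (G.cl.mul X Y))) ∧
    -- (4)
    (∀ X Y Z : U, G.lc (G.ext.mul X Y) Z = G.lc X (G.lc Y Z)) ∧
    -- (5) and (6)
    (∀ x y : V, G.lc (G.ι x) (G.ι y) = B x y • G.ext.one) ∧
    (∀ (x : V) (X Y : U), G.lc (G.ι x) (G.cl.mul X Y) =
      G.cl.mul (G.lc (G.ι x) X) Y + G.cl.mul (G.hat X) (G.lc (G.ι x) Y)) ∧
    (∀ (x : V) (X Y : U), G.lc (G.ι x) (G.ext.mul X Y) =
      G.ext.mul (G.lc (G.ι x) X) Y + G.ext.mul (G.hat X) (G.lc (G.ι x) Y)) ∧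
    -- (7)
    (∀ (x : V) (p : ℕ) (v : Fin p → V),
      G.lc (G.ι x) (G.cl.prod (fun i => G.ι (v i))) =
        ∑ k : Fin p, (-1 : R) ^ (k : ℕ) •
          G.cl.prod (Function.update (fun i => G.ι (v i)) k (G.lc (G.ι x) (G.ι (v k))))) ∧
    -- (8)
    (∀ (x : V) (p : ℕ) (v : Fin p → V),
      G.lc (G.ι x) (G.ext.prod (fun i => G.ι (v i))) =
        ∑ k : Fin p, (-1 : R) ^ (k : ℕ) •
          G.ext.prod (Function.update (fun i => G.ι (v i)) k (G.lc (G.ι x) (G.ι (v k))))) ∧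
    -- (9)
    (∀ (p : ℕ) (v : Fin p → V), (∀ i j, i ≠ j → B (v i) (v j) = 0) →
      G.cl.prod (fun i => G.ι (v i)) = G.ext.prod (fun i => G.ι (v i))) := by

  exact ⟨⟨G.cl_one_eq_ext_one, G.cl_vec_mul⟩, ⟨G.clRev_eq_extRev, G.clRev_of_mem_grade⟩,
    ⟨G.clRev_rc, G.scalar_eq_gradeProj, fun r s X hX Y hY =>
      ⟨G.ext_mul_eq_gradeProj hX hY, G.lc_eq_gradeProj hX hY, G.rc_eq_gradeProj hX hY,
        G.cl_mul_eq_sum_gradeProj hX hY⟩⟩,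
    G.lc_ext_mul, GeomAlg.GeometricAlgebra.lc_vec_vec hB G, G.lc_vec_mul G.represents_cl,
    G.lc_vec_mul G.represents_ext, G.lc_vec_prod G.represents_cl,
    G.lc_vec_prod G.represents_ext, GeomAlg.GeometricAlgebra.cl_prod_eq_ext_prod hB G⟩
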